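/- Let $\mathcal H$ be a real Hilbert space of arbitrary (possibly infinite) dimension, and let $$\mathbb H=\{(x,t)\in\mathcal H\times(0,\infty): t^2-\|x\|^2=1\}$$ be the real hyperbolic space relative to $\mathcal H$, with the metric $d_{\mathbb H}$ determined by $\cosh d_{\mathbb H}((x,t),(y,s))=ts-\langle x,y\rangle$, its metric topology and its Borel $\sigma$-algebra. A finite signed Borel measure $\eta$ on $\mathbb H$ is called Radon if its variation $|\eta|$ is inner regular with respect to compact sets and outer regular with respect to open sets on every Borel set. Let $$\mathfrak M_1(\mathbb H;t)=\{\eta \text{ real finite signed Radon measure on }\mathbb H:\ \eta(\mathbb H)=0,\ d_{\mathbb H}(\cdot,z)\in L^1(|\eta|)\text{ for some } z\in\mathbb H\}.$$ Then: 1. for every $\eta\in\mathfrak M_1(\mathbb H;t)$, $d_{\mathbb H}(\cdot,z)\in L^1(|\eta|)$ for every $z\in\mathbb H$, and for all $\mu,\nu\in\mathfrak M_1(\mathbb H;t)$, $d_{\mathbb H}\in L^1(|\mu|\times|\nu|)$; 2. the map $$(\mu,\nu)\mapsto-\int_{\mathbb H}\int_{\mathbb H}d_{\mathbb H}(x,y)\,d\mu(x)\,d\nu(y)$$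 is an inner product on the real vector space $\mathfrak M_1(\mathbb H;t)$ (bilinear, symmetric, nonnegative on the diagonal, and zero on the diagonal only at $\mu=0$); 3. $(\mathbb H,d_{\mathbb H})$ is a metric space of strong negative type: $\sum_{i,j=1}^n c_ic_jd_{\mathbb H}(x_i,x_j)\le 0$ for all $x_1,\dots,x_n\in\mathbb H$ and real $c_1,\dots,c_n$ with $\sum_i c_i=0$, and any two Radon probability measures $P,Q$ on $\mathbb H$ that integrate $d_{\mathbb H}(\cdot,z)$ for every $z\in\mathbb H$ and satisfy $-\int_{\mathbb H}\int_{\mathbb H}d_{\mathbb H}(x,y)\,d[P-Q](x)\,d[P-Q](y)=0$ are equal. -/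

import Mathlib

open MeasureTheory

/-- Radon measures: Borel measures that are finite on compact sets, inner regular with respect to
compact sets on every Borel set, and outer regular with respect to open sets on every Borel set. -/
structure IsRadonMeasure {X : Type*} [TopologicalSpace X] [MeasurableSpace X]
    (m : Measure X) : Prop where
  finite_compacts : ∀ K : Set X, IsCompact K → m K < ⊤
  inner_regular : ∀ A : Set X, MeasurableSet A →
    m A = ⨆ (K : Set X) (_ : K ⊆ A) (_ : IsCompact K), m K
  outer_regular : ∀ A : Set X, MeasurableSet A →
    m A = ⨅ (U : Set X) (_ : A ⊆ U) (_ : IsOpen U), m U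

/-- The bilinear expression `-∫∫ d(x,y) dμ(x) dν(y)` on signed measures. -/
noncomputable def negDistEnergy {X : Type*} [MetricSpace X] [MeasurableSpace X]
    (μ ν : SignedMeasure X) : ℝ :=
  -ν.integral (fun y => μ.integral (fun x => dist x y) (ContinuousLinearMap.lsmul ℝ ℝ))
    (ContinuousLinearMap.lsmul ℝ ℝ)

/-- Metric spaces of strong negative type: the metric is a conditionally negative definite kernel,
and `-∫∫ d(x,y) d[P-Q](x) d[P-Q](y) = 0` forces `P = Q` for all Radon probability measures `P`, `Q`
that integrate `d(·,z)` for every `z`. Measures are taken on the Borel σ-algebra of the metric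
topology. -/
structure IsStrongNegativeType (X : Type*) [MetricSpace X] [MeasurableSpace X] [BorelSpace X] :
    Prop where
  negative_type : ∀ (n : ℕ) (x : Fin n → X) (c : Fin n → ℝ), ∑ i, c i = 0 →
    ∑ i, ∑ j, c i * c j * dist (x i) (x j) ≤ 0
  strong : ∀ (P Q : Measure X) [IsProbabilityMeasure P] [IsProbabilityMeasure Q],
    IsRadonMeasure P → IsRadonMeasure Q →
    (∀ z, Integrable (fun x => dist x z) P) → (∀ z, Integrable (fun x => dist x z) Q) →
    negDistEnergy (P.toSignedMeasure - Q.toSignedMeasure)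
      (P.toSignedMeasure - Q.toSignedMeasure) = 0 → P = Q

/-- The variation of a signed measure is finite. -/
theorem signedMeasure_variation_finite {X : Type*} [MeasurableSpace X] (μ : SignedMeasure X) :
    IsFiniteMeasure μ.variation := by
  rw [← SignedMeasure.totalVariation_eq_variation]; infer_instance

section Measures

variable {X : Type*} [MetricSpace X] [MeasurableSpace X] [BorelSpace X]

theorem isRadonMeasure_iff_innerRegular (m : Measure X) [IsFiniteMeasure m] :
    IsRadonMeasure m ↔ m.InnerRegular := by
  constructor
  · intro h
    refine ⟨fun A hA r hr => ?_⟩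
    rw [h.inner_regular A hA] at hr
    simp only [lt_iSup_iff] at hr
    obtain ⟨K, hKA, hK, hr⟩ := hr
    exact ⟨K, hKA, hK, hr⟩
  · intro h
    exact ⟨fun K _ => measure_lt_top m K, fun A hA => hA.measure_eq_iSup_isCompact m,
      fun A _ => A.measure_eq_iInf_isOpen m⟩

theorem innerRegular_of_le {m m' : Measure X} [IsFiniteMeasure m'] (h : m ≤ m')
    (h' : m'.InnerRegular) : m.InnerRegular := by
  have : IsFiniteMeasure m := isFiniteMeasure_of_le m' h
  refine ⟨fun A hA r hr => ?_⟩
  obtain ⟨K, hKA, hK, hd⟩ := hA.exists_isCompact_sdiff_lt (μ := m') (measure_ne_top _ _)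
    (ε := m A - r) (tsub_pos_of_lt hr).ne'
  refine ⟨K, hKA, hK, ?_⟩
  by_contra hcon
  have h1 : m A ≤ m K + m (A \ K) := by
    rw [← measure_inter_add_sdiff A hK.measurableSet]
    gcongr
    exact Set.inter_subset_right
  have h2 : m A < r + (m A - r) :=
    h1.trans_lt (ENNReal.add_lt_add_of_le_of_lt (measure_ne_top _ _) (not_lt.1 hcon)
      ((h _).trans_lt hd))
  rw [add_tsub_cancel_of_le hr.le] at h2
  exact lt_irrefl _ h2

theorem isRadonMeasure_variation_of_le {μ : SignedMeasure X} {m : Measure X} [IsFiniteMeasure m]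
    (h : μ.variation ≤ m) (hm : m.InnerRegular) : IsRadonMeasure μ.variation := by
  have := signedMeasure_variation_finite μ
  exact (isRadonMeasure_iff_innerRegular _).2 (innerRegular_of_le h hm)

theorem isRadonMeasure_variation_iff (μ : SignedMeasure X) :
    IsRadonMeasure μ.variation ↔ μ.variation.InnerRegular := by
  have := signedMeasure_variation_finite μ
  exact isRadonMeasure_iff_innerRegular _

/-- Integrability of `d(·,z)` for some `z` is equivalent to integrability for every `z`. -/
theorem integrable_dist_of_integrable_dist {m : Measure X} [IsFiniteMeasure m] {z : X}
    (h : Integrable (fun x => dist x z) m) (w : X) : Integrable (fun x => dist x w) m := by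
  refine (h.add (integrable_const (dist z w))).mono'
    (continuous_id.dist continuous_const).measurable.aestronglyMeasurable
    (Filter.Eventually.of_forall fun x => ?_)
  simpa [abs_of_nonneg dist_nonneg] using dist_triangle x z w

variable (X)

/-- The real vector space of (finite) signed Radon measures `η` on `X` with `η(X) = 0` such that
`d(·,z)` is `|η|`-integrable for some `z`. -/
noncomputable def zeroMassMeasures [Nonempty X] : Submodule ℝ (SignedMeasure X) where
  carrier := {η | IsRadonMeasure η.variation ∧ (∃ z, Integrable (fun x => dist x z) η.variation) ∧
    η Set.univ = 0}
  zero_mem' := by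
    refine ⟨(isRadonMeasure_variation_iff _).2 ?_, ⟨Classical.arbitrary X, ?_⟩, rfl⟩
    · rw [VectorMeasure.variation_zero]; infer_instance
    · rw [VectorMeasure.variation_zero]; exact integrable_zero_measure
  add_mem' := by
    rintro μ ν ⟨hμ, ⟨z, hz⟩, h0⟩ ⟨hν, ⟨w, hw⟩, k0⟩
    have := signedMeasure_variation_finite μ
    have := signedMeasure_variation_finite ν
    rw [isRadonMeasure_variation_iff] at hμ hν
    refine ⟨isRadonMeasure_variation_of_le VectorMeasure.variation_add_le inferInstance, ⟨z, ?_⟩,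
      by simp [h0, k0]⟩
    exact (hz.add_measure (integrable_dist_of_integrable_dist hw z)).mono_measure
      VectorMeasure.variation_add_le
  smul_mem' := by
    rintro c μ ⟨hμ, ⟨z, hz⟩, h0⟩
    have := signedMeasure_variation_finite μ
    rw [isRadonMeasure_variation_iff] at hμ
    refine ⟨(isRadonMeasure_variation_iff _).2 ?_, ⟨z, ?_⟩, by simp [h0]⟩
    · rw [VectorMeasure.variation_smul]; infer_instance
    · rw [VectorMeasure.variation_smul]; exact hz.smul_measure_nnreal

end Measures

/-- The real hyperbolic space relative to the real inner product space `E` (hyperboloid model):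
pairs `(x, t)` with `x ∈ E`, `t > 0` and `t² - ‖x‖² = 1`. -/
@[ext] structure RealHyperbolicSpace (E : Type*) [NormedAddCommGroup E] [InnerProductSpace ℝ E] where
  point : E
  height : ℝ
  height_pos : 0 < height
  height_sq_sub : height ^ 2 - ‖point‖ ^ 2 = 1

namespace RealHyperbolicSpace

variable {E : Type*} [NormedAddCommGroup E] [InnerProductSpace ℝ E]

/-- The kernel `[(x,t),(y,s)] = t s - ⟪x,y⟫`. -/
noncomputable def form (p q : RealHyperbolicSpace E) : ℝ :=
  p.height * q.height - inner ℝ p.point q.point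

theorem form_self (p : RealHyperbolicSpace E) : form p p = 1 := by
  have := p.height_sq_sub
  rw [form, real_inner_self_eq_norm_sq]; linarith

theorem form_comm (p q : RealHyperbolicSpace E) : form p q = form q p := by
  rw [form, form, real_inner_comm, mul_comm]

/-- The Lorentz form is positive on the orthogonal complement of a point. -/
theorem sq_le_of_orthogonal (q : RealHyperbolicSpace E) (u : E) (a : ℝ)
    (h : a * q.height = inner ℝ u q.point) : a ^ 2 ≤ ‖u‖ ^ 2 := by
  have h1 := q.height_sq_sub
  have h2 : (a * q.height) ^ 2 ≤ (‖u‖ * ‖q.point‖) ^ 2 := by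
    rw [h]; exact sq_le_sq' (by
      have := (abs_le.1 (abs_real_inner_le_norm u q.point)).1; linarith)
      (real_inner_le_norm _ _)
  have h3 : 0 < q.height ^ 2 := pow_pos q.height_pos 2
  have h4 : a ^ 2 * q.height ^ 2 ≤ ‖u‖ ^ 2 * q.height ^ 2 := by
    nlinarith [sq_nonneg ‖u‖]
  exact le_of_mul_le_mul_right h4 h3

theorem one_le_form (p q : RealHyperbolicSpace E) : 1 ≤ form p q := by
  have hp := p.height_sq_sub
  have hq := q.height_sq_sub
  have h1 : (1 + ‖p.point‖ * ‖q.point‖) ^ 2 ≤ (p.height * q.height) ^ 2 := by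
    rw [mul_pow, show p.height ^ 2 = 1 + ‖p.point‖ ^ 2 by linarith,
      show q.height ^ 2 = 1 + ‖q.point‖ ^ 2 by linarith]
    nlinarith [sq_nonneg (‖p.point‖ - ‖q.point‖)]
  have h2 := le_of_sq_le_sq h1 (mul_pos p.height_pos q.height_pos).le
  have := real_inner_le_norm p.point q.point
  rw [form]; linarith

theorem form_sub_sq_le (p q r : RealHyperbolicSpace E) :
    (form p r - form p q * form q r) ^ 2 ≤ (form p q ^ 2 - 1) * (form q r ^ 2 - 1) := by
  have hp := p.height_sq_sub
  have hq := q.height_sq_sub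
  have hr := r.height_sq_sub
  have key : ∀ s : ℝ, 0 ≤ (form p q ^ 2 - 1) * (s * s) +
      (2 * (form p q * form q r - form p r)) * s + (form q r ^ 2 - 1) := by
    intro s
    have h := sq_le_of_orthogonal q
      (s • (p.point - form p q • q.point) + (r.point - form q r • q.point))
      (s * (p.height - form p q * q.height) + (r.height - form q r * q.height)) (by
        simp only [inner_add_left, inner_sub_left, real_inner_smul_left,
          real_inner_self_eq_norm_sq]
        have e1 : inner ℝ p.point q.point = p.height * q.height - form p q := by rw [form]; ring
        have e2 : inner ℝ r.point q.point = r.height * q.height - form q r := by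
          rw [form_comm, form]; ring
        rw [e1, e2, show ‖q.point‖ ^ 2 = q.height ^ 2 - 1 by linarith]
        ring)
    rw [← real_inner_self_eq_norm_sq] at h
    simp only [inner_add_left, inner_sub_left, real_inner_smul_left, inner_add_right,
      inner_sub_right, real_inner_smul_right] at h
    simp only [real_inner_self_eq_norm_sq] at h
    rw [real_inner_comm p.point q.point, real_inner_comm p.point r.point,
      real_inner_comm q.point r.point] at h
    have e1 : inner ℝ p.point q.point = p.height * q.height - form p q := by rw [form]; ring
    have e2 : inner ℝ q.point r.point = q.height * r.height - form q r := by rw [form]; ring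
    have e3 : inner ℝ p.point r.point = p.height * r.height - form p r := by rw [form]; ring
    simp only [e1, e2, e3] at h
    rw [show ‖p.point‖ ^ 2 = p.height ^ 2 - 1 by linarith,
      show ‖q.point‖ ^ 2 = q.height ^ 2 - 1 by linarith,
      show ‖r.point‖ ^ 2 = r.height ^ 2 - 1 by linarith] at h
    linarith
  have := discrim_le_zero key
  rw [discrim] at this
  linarith

/-- The hyperbolic distance, determined by `cosh (dist p q) = [p,q]`. -/
noncomputable instance : Dist (RealHyperbolicSpace E) := ⟨fun p q => Real.arcosh (form p q)⟩

theorem cosh_dist (p q : RealHyperbolicSpace E) : Real.cosh (dist p q) = form p q :=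
  Real.cosh_arcosh (one_le_form p q)

theorem dist_nonneg' (p q : RealHyperbolicSpace E) : 0 ≤ dist p q :=
  Real.arcosh_nonneg (one_le_form p q)

noncomputable instance : MetricSpace (RealHyperbolicSpace E) where
  dist_self p := by
    change Real.arcosh (form p p) = 0
    rw [form_self]; exact Real.arcosh_zero
  dist_comm p q := by
    change Real.arcosh (form p q) = Real.arcosh (form q p)
    rw [form_comm]
  dist_triangle p q r := by
    have hn : 0 ≤ dist p q + dist q r := add_nonneg (dist_nonneg' p q) (dist_nonneg' q r)
    have hc : Real.cosh (dist p r) ≤ Real.cosh (dist p q + dist q r) := by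
      rw [Real.cosh_add, cosh_dist, cosh_dist, cosh_dist]
      have h := form_sub_sq_le p q r
      have e1 := Real.sinh_sq (dist p q)
      have e2 := Real.sinh_sq (dist q r)
      rw [cosh_dist] at e1 e2
      rw [← e1, ← e2, ← mul_pow] at h
      have := le_of_sq_le_sq h (mul_nonneg (Real.sinh_nonneg_iff.2 (dist_nonneg' p q))
        (Real.sinh_nonneg_iff.2 (dist_nonneg' q r)))
      linarith
    have := Real.cosh_le_cosh.1 hc
    rwa [abs_of_nonneg (dist_nonneg' p r), abs_of_nonneg hn] at this
  eq_of_dist_eq_zero := by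
    intro p q h
    have h1 : form p q = 1 := by rw [← cosh_dist, h, Real.cosh_zero]
    have hp := p.height_sq_sub
    have hq := q.height_sq_sub
    rw [form] at h1
    have hn : ‖p.point - q.point‖ ^ 2 = (p.height - q.height) ^ 2 := by
      rw [norm_sub_sq_real]; nlinarith
    have hi : inner ℝ (p.point - q.point) q.point = (p.height - q.height) * q.height := by
      rw [inner_sub_left, real_inner_self_eq_norm_sq]; linarith
    have hcs := abs_real_inner_le_norm (p.point - q.point) q.point
    have hsq := pow_le_pow_left₀ (abs_nonneg _) hcs 2
    rw [sq_abs, hi, mul_pow, mul_pow, hn,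
      show ‖q.point‖ ^ 2 = q.height ^ 2 - 1 by linarith] at hsq
    have hz : (p.height - q.height) ^ 2 = 0 := le_antisymm (by linarith) (sq_nonneg _)
    rw [hz] at hn
    exact RealHyperbolicSpace.ext (sub_eq_zero.1 (norm_eq_zero.1 (pow_eq_zero_iff two_ne_zero |>.1 hn)))
      (sub_eq_zero.1 (pow_eq_zero_iff two_ne_zero |>.1 hz))

instance : Nonempty (RealHyperbolicSpace E) := ⟨⟨0, 1, one_pos, by simp⟩⟩

/-- The Borel σ-algebra of the metric topology. -/
noncomputable instance : MeasurableSpace (RealHyperbolicSpace E) := borel _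

instance : BorelSpace (RealHyperbolicSpace E) := ⟨rfl⟩

end RealHyperbolicSpace

/-! Write `u = [p,q] = t s (1 - k)`, where `k` is the inner product in the Klein ball, so `|k| < 1`,
and put `w = u⁻²`. Since `d = log (u + √(u² - 1))`, one gets `d = log 2 + log t + log s + log (1 -
k) + log (1 - v)`, where `v = (1 - √(1 - w)) / 2` is the smaller root of `v = w/4 + v²`. By the
Schur product theorem the kernels `-log (1 - k)`, `w = t⁻² s⁻² (1 - k)⁻²`, `v` (a limit of
polynomials in `w` with nonnegative coefficients) and `-log (1 - v)` are all positive semidefinite.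
Hence `-d` is positive semidefinite up to terms in one variable, which zero mass annihilates
(`distKernel_eq`, `dist_negativeType`).

Definiteness comes from keeping track of what the kernel dominates. Order kernels by `K ≥ L` when `K
- L` is positive semidefinite. As `v ≥ w/4`, the kernel of `-d` dominates a positive multiple of
every `w ^ (n + 1)`, and `w` dominates `g ⊗ g` for `g = t⁻²` and `g = t⁻³ ⟪a, x⟫` with `‖a‖ ≤ 1`. If
`μ` has zero energy, then `∫ g dμ = 0` for all products of such `g`
(`mul_sq_integral_le_negDistEnergy`), and for constants because `μ` has mass zero. These functions
generate an algebra separating points, so Stone–Weierstrass for inner regular measures gives `μ⁺ =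
μ⁻`.

The passage from finite sums to integrals is by averaging over independent samples. No separability
is assumed: a finite inner regular measure lives on a σ-compact set, which settles measurability on
products. -/

open Filter Topology
open scoped BoundedContinuousFunction

/-! ### Positive semidefinite kernels and the order they define. -/

/-- Real symmetric positive semidefinite kernels. -/
structure IsPosSemidefKernel {X : Type*} (K : X → X → ℝ) : Prop where
  symm : ∀ x y, K x y = K y x
  sum_nonneg : ∀ (n : ℕ) (x : Fin n → X) (c : Fin n → ℝ),
    0 ≤ ∑ i, ∑ j, c i * c j * K (x i) (x j)

namespace IsPosSemidefKernel

variable {X : Type*} {K L K' L' : X → X → ℝ}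

theorem iff_matrix : IsPosSemidefKernel K ↔
    ∀ (n : ℕ) (x : Fin n → X), (Matrix.of fun i j => K (x i) (x j)).PosSemidef := by
  have key : ∀ (n : ℕ) (x : Fin n → X) (c : Fin n → ℝ),
      star c ⬝ᵥ (Matrix.of fun i j => K (x i) (x j)).mulVec c
        = ∑ i, ∑ j, c i * c j * K (x i) (x j) := by
    intro n x c
    simp only [dotProduct, Matrix.mulVec, Pi.star_apply, star_trivial, Matrix.of_apply,
      Finset.mul_sum]
    exact Finset.sum_congr rfl fun i _ => Finset.sum_congr rfl fun j _ => by ring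
  constructor
  · intro h n x
    refine Matrix.posSemidef_iff_dotProduct_mulVec.2 ⟨?_, fun c => ?_⟩
    · ext i j
      simp [h.symm (x j) (x i)]
    · rw [key]; exact h.sum_nonneg n x c
  · intro h
    refine ⟨fun x y => ?_, fun n x c => ?_⟩
    · have := (h 2 ![x, y]).isHermitian.apply 1 0
      simpa using this
    · rw [← key]; exact (Matrix.posSemidef_iff_dotProduct_mulVec.1 (h n x)).2 c

/-- Schur product theorem. With sums and limits, it makes power series with nonnegative coefficients
preserve positive semidefiniteness. -/
theorem mul (hK : IsPosSemidefKernel K) (hL : IsPosSemidefKernel L) :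
    IsPosSemidefKernel fun x y => K x y * L x y :=
  iff_matrix.2 fun n x => (iff_matrix.1 hK n x).hadamard (iff_matrix.1 hL n x)

theorem add (hK : IsPosSemidefKernel K) (hL : IsPosSemidefKernel L) :
    IsPosSemidefKernel fun x y => K x y + L x y where
  symm x y := by rw [hK.symm, hL.symm]
  sum_nonneg n x c := by
    simp only [mul_add, Finset.sum_add_distrib]
    exact add_nonneg (hK.sum_nonneg n x c) (hL.sum_nonneg n x c)

theorem rankOne (g : X → ℝ) : IsPosSemidefKernel fun x y => g x * g y where
  symm x y := mul_comm _ _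
  sum_nonneg n x c := by
    have : ∑ i, ∑ j, c i * c j * (g (x i) * g (x j)) = (∑ i, c i * g (x i)) ^ 2 := by
      rw [sq, Finset.sum_mul_sum]
      exact Finset.sum_congr rfl fun i _ => Finset.sum_congr rfl fun j _ => by ring
    rw [this]; positivity

theorem const {a : ℝ} (ha : 0 ≤ a) : IsPosSemidefKernel fun _ _ : X => a := by
  simpa [Real.mul_self_sqrt ha] using rankOne fun _ : X => √a

theorem const_mul (hK : IsPosSemidefKernel K) {a : ℝ} (ha : 0 ≤ a) :
    IsPosSemidefKernel fun x y => a * K x y :=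
  (const ha).mul hK

theorem pow (hK : IsPosSemidefKernel K) (n : ℕ) : IsPosSemidefKernel fun x y => K x y ^ n := by
  induction n with
  | zero => simpa using const (X := X) zero_le_one
  | succ n ih => simpa [pow_succ] using ih.mul hK

theorem of_tendsto {F : ℕ → X → X → ℝ} (hF : ∀ n, IsPosSemidefKernel (F n))
    (h : ∀ x y, Filter.Tendsto (fun n => F n x y) Filter.atTop (nhds (K x y))) :
    IsPosSemidefKernel K where
  symm x y := tendsto_nhds_unique (h x y) (by simpa only [(hF _).symm x y] using h y x)
  sum_nonneg n x c := ge_of_tendsto'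
    (tendsto_finsetSum _ fun i _ => tendsto_finsetSum _ fun j _ =>
      (h (x i) (x j)).const_mul (c i * c j))
    fun k => (hF k).sum_nonneg n x c

theorem finsetSum {ι : Type*} {F : ι → X → X → ℝ} (hF : ∀ i, IsPosSemidefKernel (F i))
    (s : Finset ι) : IsPosSemidefKernel fun x y => ∑ i ∈ s, F i x y := by
  classical
  induction s using Finset.induction_on with
  | empty => simpa using const (X := X) le_rfl
  | insert i s hi ih => simpa [Finset.sum_insert hi] using (hF i).add ih

theorem of_hasSum {F : ℕ → X → X → ℝ} (hF : ∀ n, IsPosSemidefKernel (F n))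
    (h : ∀ x y, HasSum (fun n => F n x y) (K x y)) : IsPosSemidefKernel K :=
  of_tendsto (fun n => finsetSum hF (Finset.range n)) fun x y => (h x y).tendsto_sum_nat

/-- The sum of a series of positive semidefinite kernels dominates each term. -/
theorem hasSum_sub {F : ℕ → X → X → ℝ} (hF : ∀ n, IsPosSemidefKernel (F n))
    (h : ∀ x y, HasSum (fun n => F n x y) (K x y)) (n : ℕ) :
    IsPosSemidefKernel fun x y => K x y - F n x y := by
  refine of_hasSum (F := fun k x y => if k = n then 0 else F k x y) (fun k => ?_) fun x y => ?_
  · by_cases hk : k = n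
    · simpa [hk] using const (X := X) le_rfl
    · simpa [hk] using hF k
  · exact hasSum_ite_sub_hasSum (h x y) n

/-- `K K' - L L' = K (K' - L') + (K - L) L'`: domination is multiplicative. -/
theorem mul_sub_mul (hK : IsPosSemidefKernel K) (hL' : IsPosSemidefKernel L')
    (h : IsPosSemidefKernel fun x y => K x y - L x y)
    (h' : IsPosSemidefKernel fun x y => K' x y - L' x y) :
    IsPosSemidefKernel fun x y => K x y * K' x y - L x y * L' x y := by
  convert (hK.mul h').add (h.mul hL') using 3 with x y
  ring

theorem pow_sub_pow (hK : IsPosSemidefKernel K) (hL : IsPosSemidefKernel L)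
    (h : IsPosSemidefKernel fun x y => K x y - L x y) (n : ℕ) :
    IsPosSemidefKernel fun x y => K x y ^ n - L x y ^ n := by
  induction n with
  | zero => simpa using const (X := X) le_rfl
  | succ n ih => simpa [pow_succ] using (hK.pow n).mul_sub_mul hL ih h

/-- Test the form on the weights `(1, 1)` and `(1, -1)`. This reduces integrability on the product
to integrability on the diagonal. -/
theorem abs_le (hK : IsPosSemidefKernel K) (x y : X) : |K x y| ≤ (K x x + K y y) / 2 := by
  have h1 := hK.sum_nonneg 2 ![x, y] ![1, 1]
  have h2 := hK.sum_nonneg 2 ![x, y] ![1, -1]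
  have := hK.symm x y
  simp [Fin.sum_univ_two] at h1 h2
  rw [_root_.abs_le]
  constructor <;> linarith

end IsPosSemidefKernel

/-! ### A square root as a limit of polynomials with nonnegative coefficients. -/

/-- The iteration `v ↦ x / 4 + v ^ 2` started at `0`, converging to the smallest fixed point. -/
noncomputable def quadraticIterate (x : ℝ) : ℕ → ℝ
  | 0 => 0
  | n + 1 => x / 4 + quadraticIterate x n ^ 2

theorem half_one_sub_sqrt_eq {x : ℝ} (hx : x ≤ 1) :
    (1 - √(1 - x)) / 2 = x / 4 + ((1 - √(1 - x)) / 2) ^ 2 := by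
  have := Real.sq_sqrt (sub_nonneg.2 hx)
  linarith

/-- The iterates increase and stay below the fixed point `V`, so they converge to a fixed point `l ≤
V`; the other fixed point is `1 - V ≥ V`. -/
theorem tendsto_quadraticIterate {x : ℝ} (h0 : 0 ≤ x) (hx : x ≤ 1) :
    Tendsto (quadraticIterate x) atTop (𝓝 ((1 - √(1 - x)) / 2)) := by
  have hfix := half_one_sub_sqrt_eq hx
  have hV : 0 ≤ (1 - √(1 - x)) / 2 := by
    have : √(1 - x) ≤ 1 := Real.sqrt_le_one.2 (by linarith)
    linarith
  set V := (1 - √(1 - x)) / 2 with hVdef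
  have hV2 : V ≤ 1 / 2 := by have := Real.sqrt_nonneg (1 - x); linarith
  have hnn : ∀ n, 0 ≤ quadraticIterate x n := by
    intro n
    cases n with
    | zero => exact le_rfl
    | succ n => exact add_nonneg (by linarith) (sq_nonneg _)
  have hle : ∀ n, quadraticIterate x n ≤ V := by
    intro n
    induction n with
    | zero => exact hV
    | succ n ih =>
      rw [hfix]
      exact add_le_add le_rfl (pow_le_pow_left₀ (hnn n) ih 2)
  have hmono : Monotone (quadraticIterate x) := by
    refine monotone_nat_of_le_succ fun n => ?_
    induction n with
    | zero => exact hnn 1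
    | succ n ih => exact add_le_add le_rfl (pow_le_pow_left₀ (hnn n) ih 2)
  have hlim := tendsto_atTop_ciSup hmono ⟨V, by rintro _ ⟨n, rfl⟩; exact hle n⟩
  set l := ⨆ n, quadraticIterate x n
  have hl : l ≤ V := le_of_tendsto' hlim hle
  have hl2 : l = x / 4 + l ^ 2 :=
    tendsto_nhds_unique ((tendsto_add_atTop_iff_nat 1).2 hlim) ((hlim.pow 2).const_add (x / 4))
  rcases eq_or_ne l V with h | h
  · rwa [← h]
  · exfalso
    -- Subtract the two fixed point equations; `l < V ≤ 1/2` rules out `V + l = 1`.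
    have h1 : (V - l) * (V + l - 1) = 0 := by nlinarith
    have h2 : 0 < V - l := sub_pos.2 (lt_of_le_of_ne hl h)
    have := (mul_eq_zero.1 h1).resolve_left h2.ne'
    linarith

/-! ### The hyperbolic distance as a kernel of negative type. -/

namespace RealHyperbolicSpace

variable {E : Type*} [NormedAddCommGroup E] [InnerProductSpace ℝ E]

theorem one_le_height (p : RealHyperbolicSpace E) : 1 ≤ p.height := by
  have := p.height_sq_sub
  nlinarith [p.height_pos, sq_nonneg ‖p.point‖]

theorem norm_point_lt_height (p : RealHyperbolicSpace E) : ‖p.point‖ < p.height :=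
  lt_of_pow_lt_pow_left₀ 2 p.height_pos.le (by linarith [p.height_sq_sub])

/-- The inner product of the images in the Klein ball model. -/
noncomputable def kleinInner (p q : RealHyperbolicSpace E) : ℝ :=
  p.height⁻¹ * q.height⁻¹ * inner ℝ p.point q.point

theorem form_eq (p q : RealHyperbolicSpace E) :
    form p q = p.height * q.height * (1 - kleinInner p q) := by
  have := p.height_pos.ne'
  have := q.height_pos.ne'
  rw [form, kleinInner]
  field_simp

theorem abs_kleinInner_lt_one (p q : RealHyperbolicSpace E) : |kleinInner p q| < 1 := by
  have hp := p.height_pos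
  have hq := q.height_pos
  rw [kleinInner, abs_mul, abs_of_pos (by positivity), ← mul_inv, inv_mul_lt_iff₀ (by positivity),
    mul_one]
  exact (abs_real_inner_le_norm _ _).trans_lt
    (mul_lt_mul'' p.norm_point_lt_height q.norm_point_lt_height (norm_nonneg _) (norm_nonneg _))

theorem isPosSemidefKernel_inner : IsPosSemidefKernel fun x y : E => inner ℝ x y where
  symm x y := real_inner_comm y x
  sum_nonneg n x c := by
    have : ∑ i, ∑ j, c i * c j * inner ℝ (x i) (x j)
        = inner ℝ (∑ i, c i • x i) (∑ i, c i • x i) := by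
      simp only [sum_inner, inner_sum, real_inner_smul_left, real_inner_smul_right]
      exact Finset.sum_congr rfl fun i _ => Finset.sum_congr rfl fun j _ => by
        rw [real_inner_comm]; ring
    rw [this]; exact real_inner_self_nonneg

/-- Cauchy–Schwarz for `w` and `∑ cᵢ xᵢ`. -/
theorem isPosSemidefKernel_inner_sub {w : E} (hw : ‖w‖ ≤ 1) :
    IsPosSemidefKernel fun x y : E => inner ℝ x y - inner ℝ w x * inner ℝ w y where
  symm x y := by rw [real_inner_comm y x, mul_comm]
  sum_nonneg n x c := by
    have : ∑ i, ∑ j, c i * c j * (inner ℝ (x i) (x j) - inner ℝ w (x i) * inner ℝ w (x j))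
        = inner ℝ (∑ i, c i • x i) (∑ i, c i • x i) - inner ℝ w (∑ i, c i • x i) ^ 2 := by
      simp only [sq, sum_inner, inner_sum, real_inner_smul_left, real_inner_smul_right,
        Finset.sum_mul_sum, mul_sub, Finset.sum_sub_distrib]
      congr 1
      · exact Finset.sum_congr rfl fun i _ => Finset.sum_congr rfl fun j _ => by
          rw [real_inner_comm]; ring
      · exact Finset.sum_congr rfl fun i _ => Finset.sum_congr rfl fun j _ => by ring
    rw [this, real_inner_self_eq_norm_sq, sub_nonneg]
    refine sq_le_sq' ?_ ?_
    · have := (abs_le.1 (abs_real_inner_le_norm w (∑ i, c i • x i))).1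
      nlinarith [norm_nonneg (∑ i, c i • x i)]
    · have := real_inner_le_norm w (∑ i, c i • x i)
      nlinarith [norm_nonneg (∑ i, c i • x i)]

theorem _root_.IsPosSemidefKernel.comp {X Y : Type*} {K : X → X → ℝ} (hK : IsPosSemidefKernel K)
    (f : Y → X) : IsPosSemidefKernel fun x y => K (f x) (f y) :=
  ⟨fun _ _ => hK.symm _ _, fun n x c => hK.sum_nonneg n (f ∘ x) c⟩

theorem isPosSemidefKernel_kleinInner :
    IsPosSemidefKernel (kleinInner : RealHyperbolicSpace E → RealHyperbolicSpace E → ℝ) :=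
  (IsPosSemidefKernel.rankOne fun p : RealHyperbolicSpace E => p.height⁻¹).mul
    (isPosSemidefKernel_inner.comp point)

theorem isPosSemidefKernel_inv_one_sub_kleinInner :
    IsPosSemidefKernel fun p q : RealHyperbolicSpace E => (1 - kleinInner p q)⁻¹ :=
  .of_hasSum (fun n => isPosSemidefKernel_kleinInner.pow n) fun p q =>
    hasSum_geometric_of_abs_lt_one (abs_kleinInner_lt_one p q)

/-- The geometric series dominates each of its terms; the exponents 0 and 1 produce the functions
that will separate points. -/
theorem isPosSemidefKernel_inv_one_sub_kleinInner_sub_pow (n : ℕ) :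
    IsPosSemidefKernel fun p q : RealHyperbolicSpace E =>
      (1 - kleinInner p q)⁻¹ - kleinInner p q ^ n :=
  .hasSum_sub (fun n => isPosSemidefKernel_kleinInner.pow n) (fun p q =>
    hasSum_geometric_of_abs_lt_one (abs_kleinInner_lt_one p q)) n

theorem isPosSemidefKernel_neg_log_one_sub_kleinInner :
    IsPosSemidefKernel fun p q : RealHyperbolicSpace E => -Real.log (1 - kleinInner p q) := by
  refine .of_hasSum (F := fun n p q => kleinInner p q ^ (n + 1) / (n + 1)) (fun n => ?_) fun p q =>
    Real.hasSum_pow_div_log_of_abs_lt_one (abs_kleinInner_lt_one p q)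
  simpa only [div_eq_inv_mul] using
    (isPosSemidefKernel_kleinInner.pow (n + 1)).const_mul (a := ((n : ℝ) + 1)⁻¹) (by positivity)

/-- The kernel `[p,q]⁻²`. -/
noncomputable def invFormSq (p q : RealHyperbolicSpace E) : ℝ := (form p q ^ 2)⁻¹

theorem invFormSq_pos (p q : RealHyperbolicSpace E) : 0 < invFormSq p q :=
  inv_pos.2 (pow_pos (zero_lt_one.trans_le (one_le_form p q)) 2)

theorem invFormSq_le_one (p q : RealHyperbolicSpace E) : invFormSq p q ≤ 1 :=
  inv_le_one_of_one_le₀ (one_le_pow₀ (one_le_form p q))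

theorem invFormSq_eq (p q : RealHyperbolicSpace E) : invFormSq p q =
    (p.height ^ 2)⁻¹ * (q.height ^ 2)⁻¹ * ((1 - kleinInner p q)⁻¹ * (1 - kleinInner p q)⁻¹) := by
  rw [invFormSq, form_eq]
  simp only [mul_inv, sq]
  ring

theorem isPosSemidefKernel_invFormSq :
    IsPosSemidefKernel (invFormSq : RealHyperbolicSpace E → RealHyperbolicSpace E → ℝ) := by
  convert (IsPosSemidefKernel.rankOne fun p : RealHyperbolicSpace E => (p.height ^ 2)⁻¹).mul
    (isPosSemidefKernel_inv_one_sub_kleinInner.mul isPosSemidefKernel_inv_one_sub_kleinInner)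
    using 3 with p q
  exact invFormSq_eq p q

/-- With `G = (1 - k)⁻¹`, use `G² - L = G (G - 1) + (G - L)` and `G ≥ 1`. -/
theorem isPosSemidefKernel_invFormSq_sub {L : RealHyperbolicSpace E → RealHyperbolicSpace E → ℝ}
    (h : IsPosSemidefKernel fun p q => (1 - kleinInner p q)⁻¹ - L p q) :
    IsPosSemidefKernel fun p q => invFormSq p q - (p.height ^ 2)⁻¹ * (q.height ^ 2)⁻¹ * L p q := by
  have h1 := isPosSemidefKernel_inv_one_sub_kleinInner_sub_pow (E := E) 0
  convert (IsPosSemidefKernel.rankOne fun p : RealHyperbolicSpace E => (p.height ^ 2)⁻¹).mul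
    ((isPosSemidefKernel_inv_one_sub_kleinInner.mul h1).add h) using 3 with p q
  rw [invFormSq_eq]
  ring

theorem isPosSemidefKernel_invFormSq_sub_height :
    IsPosSemidefKernel fun p q : RealHyperbolicSpace E =>
      invFormSq p q - (p.height ^ 2)⁻¹ * (q.height ^ 2)⁻¹ := by
  simpa using isPosSemidefKernel_invFormSq_sub
    (isPosSemidefKernel_inv_one_sub_kleinInner_sub_pow (E := E) 0)

/-- Chain of dominations: the geometric series dominates `k`, and `k` dominates its component along
`w`. -/
theorem isPosSemidefKernel_invFormSq_sub_inner {w : E} (hw : ‖w‖ ≤ 1) :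
    IsPosSemidefKernel fun p q : RealHyperbolicSpace E => invFormSq p q -
      ((p.height ^ 2)⁻¹ * (p.height⁻¹ * inner ℝ w p.point)) *
        ((q.height ^ 2)⁻¹ * (q.height⁻¹ * inner ℝ w q.point)) := by
  have h1 := isPosSemidefKernel_inv_one_sub_kleinInner_sub_pow (E := E) 1
  have h2 := (IsPosSemidefKernel.rankOne fun p : RealHyperbolicSpace E => p.height⁻¹).mul
    ((isPosSemidefKernel_inner_sub hw).comp point)
  have h3 : IsPosSemidefKernel fun p q : RealHyperbolicSpace E => (1 - kleinInner p q)⁻¹ -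
      (p.height⁻¹ * inner ℝ w p.point) * (q.height⁻¹ * inner ℝ w q.point) := by
    convert h1.add h2 using 3 with p q
    rw [kleinInner]
    ring
  convert isPosSemidefKernel_invFormSq_sub h3 using 3 with p q
  ring

/-- The smaller root of `v = [p,q]⁻² / 4 + v²`. -/
noncomputable def rootKernel (p q : RealHyperbolicSpace E) : ℝ := (1 - √(1 - invFormSq p q)) / 2

theorem isPosSemidefKernel_rootKernel :
    IsPosSemidefKernel (rootKernel : RealHyperbolicSpace E → RealHyperbolicSpace E → ℝ) := by
  refine .of_tendsto (F := fun n p q => quadraticIterate (invFormSq p q) n) (fun n => ?_)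
    fun p q => tendsto_quadraticIterate (invFormSq_pos p q).le (invFormSq_le_one p q)
  induction n with
  | zero => exact .const le_rfl
  | succ n ih =>
    convert (isPosSemidefKernel_invFormSq.const_mul (a := 1 / 4) (by norm_num)).add (ih.pow 2)
      using 3 with p q
    simp only [quadraticIterate]
    ring

theorem abs_rootKernel_lt_one (p q : RealHyperbolicSpace E) : |rootKernel p q| < 1 := by
  have h1 := Real.sqrt_nonneg (1 - invFormSq p q)
  have h2 : √(1 - invFormSq p q) ≤ 1 := Real.sqrt_le_one.2 (by linarith [invFormSq_pos p q])
  rw [rootKernel, abs_lt]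
  constructor <;> linarith

theorem hasSum_rootKernel (p q : RealHyperbolicSpace E) :
    HasSum (fun n : ℕ => ((n : ℝ) + 1)⁻¹ * rootKernel p q ^ (n + 1))
      (-Real.log (1 - rootKernel p q)) := by
  simpa only [div_eq_inv_mul] using
    Real.hasSum_pow_div_log_of_abs_lt_one (abs_rootKernel_lt_one p q)

theorem isPosSemidefKernel_rootKernel_pow (n : ℕ) :
    IsPosSemidefKernel fun p q : RealHyperbolicSpace E =>
      ((n : ℝ) + 1)⁻¹ * rootKernel p q ^ (n + 1) :=
  (isPosSemidefKernel_rootKernel.pow (n + 1)).const_mul (by positivity)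

/-- The distance, up to sign and terms depending on one variable only. -/
noncomputable def distKernel (p q : RealHyperbolicSpace E) : ℝ :=
  Real.log 2 + Real.log p.height + Real.log q.height - dist p q

/-- Here `u + √(u² - 1) = 2 u (1 - v)` and `u = t s (1 - k)`; the logarithm separates the factors.
-/
theorem distKernel_eq (p q : RealHyperbolicSpace E) :
    distKernel p q = -Real.log (1 - kleinInner p q) + -Real.log (1 - rootKernel p q) := by
  have hu := one_le_form p q
  have hu0 : 0 < form p q := by linarith
  have hz := (abs_lt.1 (abs_kleinInner_lt_one p q)).2
  have hv := (abs_lt.1 (abs_rootKernel_lt_one p q)).2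
  have h1 : form p q + √(form p q ^ 2 - 1) = 2 * form p q * (1 - rootKernel p q) := by
    have : form p q ^ 2 - 1 = form p q ^ 2 * (1 - invFormSq p q) := by
      rw [invFormSq]; field_simp
    rw [this, Real.sqrt_mul (sq_nonneg _), Real.sqrt_sq hu0.le, rootKernel]
    ring
  have h2 : dist p q = Real.log (form p q + √(form p q ^ 2 - 1)) := rfl
  rw [distKernel, h2, h1, Real.log_mul (by positivity) (by linarith),
    Real.log_mul two_ne_zero hu0.ne', form_eq,
    Real.log_mul (mul_pos p.height_pos q.height_pos).ne' (by linarith),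
    Real.log_mul p.height_pos.ne' q.height_pos.ne']
  ring

theorem isPosSemidefKernel_distKernel :
    IsPosSemidefKernel (distKernel : RealHyperbolicSpace E → RealHyperbolicSpace E → ℝ) := by
  convert isPosSemidefKernel_neg_log_one_sub_kleinInner.add
    (.of_hasSum isPosSemidefKernel_rootKernel_pow hasSum_rootKernel) using 3 with p q
  exact distKernel_eq p q

/-- `distKernel` dominates a positive multiple of every positive power of `[p,q]⁻²`. -/
theorem isPosSemidefKernel_distKernel_sub (n : ℕ) :
    IsPosSemidefKernel fun p q : RealHyperbolicSpace E =>
      distKernel p q - ((n : ℝ) + 1)⁻¹ * (1 / 4) ^ (n + 1) * invFormSq p q ^ (n + 1) := by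
  have h0 := isPosSemidefKernel_invFormSq (E := E).const_mul (a := 1 / 4) (by norm_num)
  have h1 := IsPosSemidefKernel.hasSum_sub isPosSemidefKernel_rootKernel_pow
    (hasSum_rootKernel (E := E)) n
  -- By the fixed point equation this difference is `v²`. Taking powers then turns the `n`-th term
  -- of the logarithm series into a multiple of `w ^ (n + 1)`.
  have h2 : IsPosSemidefKernel fun p q : RealHyperbolicSpace E =>
      rootKernel p q - 1 / 4 * invFormSq p q := by
    convert isPosSemidefKernel_rootKernel.pow 2 using 3 with p q
    have := half_one_sub_sqrt_eq (invFormSq_le_one p q)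
    rw [rootKernel]
    linarith
  have h3 := (isPosSemidefKernel_rootKernel.pow_sub_pow h0 h2 (n + 1)).const_mul
    (a := ((n : ℝ) + 1)⁻¹) (by positivity)
  convert (isPosSemidefKernel_neg_log_one_sub_kleinInner.add h1).add h3 using 3 with p q
  rw [distKernel_eq]
  ring

theorem isPosSemidefKernel_distKernel_sub_rankOne {n : ℕ} {g : RealHyperbolicSpace E → ℝ}
    (hg : IsPosSemidefKernel fun p q => invFormSq p q ^ (n + 1) - g p * g q) :
    IsPosSemidefKernel fun p q =>
      distKernel p q - ((n : ℝ) + 1)⁻¹ * (1 / 4) ^ (n + 1) * (g p * g q) := by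
  convert (isPosSemidefKernel_distKernel_sub n).add
    (hg.const_mul (a := ((n : ℝ) + 1)⁻¹ * (1 / 4) ^ (n + 1)) (by positivity)) using 3 with p q
  ring

/-- Terms depending on one variable drop out because the weights sum to zero. -/
theorem dist_negativeType (n : ℕ) (x : Fin n → RealHyperbolicSpace E) (c : Fin n → ℝ)
    (hc : ∑ i, c i = 0) : ∑ i, ∑ j, c i * c j * dist (x i) (x j) ≤ 0 := by
  have h := isPosSemidefKernel_distKernel.sum_nonneg n x c
  have h1 : ∀ i, ∑ j, c i * c j * distKernel (x i) (x j) =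
      c i * (Real.log 2 + Real.log (x i).height) * ∑ j, c j +
      c i * ∑ j, c j * Real.log (x j).height - ∑ j, c i * c j * dist (x i) (x j) := by
    intro i
    simp only [Finset.mul_sum, ← Finset.sum_add_distrib, ← Finset.sum_sub_distrib, distKernel]
    exact Finset.sum_congr rfl fun j _ => by ring
  simp only [h1, hc, mul_zero, zero_add, Finset.sum_sub_distrib, ← Finset.sum_mul, zero_mul] at h
  linarith

end RealHyperbolicSpace

/-! ### From finite sums to double integrals. -/

/-- By averaging over independent samples: a function of two variables whose
sums over all finite samples are nonnegative has a nonnegative double integral. -/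
theorem integral_prod_nonneg_of_forall_sum_nonneg_of_isProbabilityMeasure {X : Type*}
    [MeasurableSpace X] {P : Measure X} [IsProbabilityMeasure P] {F : X × X → ℝ}
    (hF : Integrable F (P.prod P)) (hdiag : Integrable (fun x => F (x, x)) P)
    (h : ∀ (n : ℕ) (x : Fin n → X), 0 ≤ ∑ i, ∑ j, F (x i, x j)) :
    0 ≤ ∫ q, F q ∂(P.prod P) := by
  have hmp : ∀ (n : ℕ) (i : Fin n),
      MeasurePreserving (fun ω : Fin n → X => ω i) (Measure.pi fun _ => P) P :=
    fun n i => measurePreserving_eval (fun _ => P) i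
  have hmp2 : ∀ (n : ℕ) (i j : Fin n), i ≠ j → MeasurePreserving
      (fun ω : Fin n → X => (ω i, ω j)) (Measure.pi fun _ => P) (P.prod P) := by
    intro n i j hij
    refine ⟨by fun_prop, ?_⟩
    -- Distinct coordinates are independent, so their joint law is `P.prod P`.
    have hind := (ProbabilityTheory.iIndepFun_pi (μ := fun _ : Fin n => P)
      (X := fun _ x => x) (fun _ => aemeasurable_id)).indepFun hij
    rw [ProbabilityTheory.indepFun_iff_map_prod_eq_prod_map_map
      (hmp n i).measurable.aemeasurable (hmp n j).measurable.aemeasurable] at hind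
    rw [hind, (hmp n i).map_eq, (hmp n j).map_eq]
  set D := ∫ x, F (x, x) ∂P
  set I := ∫ q, F q ∂(P.prod P)
  -- For a sample of size `n + 1` the expected sum is `(n + 1) (D + n I)`: each index meets itself
  -- once and `n` others. Letting `n` grow forces `I ≥ 0`.
  have key : ∀ n : ℕ, 0 ≤ D + n * I := by
    intro n
    have hint : ∀ i j : Fin (n + 1), Integrable (fun ω : Fin (n + 1) → X => F (ω i, ω j))
        (Measure.pi fun _ => P) := by
      intro i j
      by_cases hij : i = j
      · subst hij
        exact (hmp _ i).integrable_comp_of_integrable hdiag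
      · exact (hmp2 _ i j hij).integrable_comp_of_integrable hF
    have hval : ∀ i j : Fin (n + 1), ∫ ω : Fin (n + 1) → X, F (ω i, ω j) ∂(Measure.pi fun _ => P)
        = if i = j then D else I := by
      intro i j
      split_ifs with hij
      · subst hij
        have := integral_map (hmp _ i).measurable.aemeasurable (f := fun x => F (x, x))
          (by rw [(hmp _ i).map_eq]; exact hdiag.1)
        rw [(hmp _ i).map_eq] at this
        exact this.symm
      · have := integral_map (hmp2 _ i j hij).measurable.aemeasurable (f := F)
          (by rw [(hmp2 _ i j hij).map_eq]; exact hF.1)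
        rw [(hmp2 _ i j hij).map_eq] at this
        exact this.symm
    have h0 : 0 ≤ ∫ ω : Fin (n + 1) → X, ∑ i, ∑ j, F (ω i, ω j) ∂(Measure.pi fun _ => P) :=
      integral_nonneg fun ω => h (n + 1) ω
    rw [integral_finsetSum _ fun i _ => integrable_finsetSum _ fun j _ => hint i j] at h0
    have h1 : ∀ i : Fin (n + 1),
        ∫ ω : Fin (n + 1) → X, ∑ j, F (ω i, ω j) ∂(Measure.pi fun _ => P) = D + n * I := by
      intro i
      rw [integral_finsetSum _ fun j _ => hint i j]
      simp only [hval]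
      have : ∀ j, (if i = j then D else I) = I + if i = j then D - I else 0 := by
        intro j; split_ifs <;> ring
      simp only [this, Finset.sum_add_distrib, Finset.sum_ite_eq, Finset.mem_univ, if_true,
        Finset.sum_const, Finset.card_univ, Fintype.card_fin, nsmul_eq_mul]
      push_cast
      ring
    simp only [h1, Finset.sum_const, Finset.card_univ, Fintype.card_fin, nsmul_eq_mul] at h0
    exact nonneg_of_mul_nonneg_right h0 (by positivity)
  by_contra hI
  push Not at hI
  obtain ⟨n, hn⟩ := exists_nat_gt (D / -I)
  rw [div_lt_iff₀ (by linarith)] at hn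
  have := key n
  linarith

theorem integral_prod_nonneg_of_forall_sum_nonneg {X : Type*}
    [MeasurableSpace X] {m : Measure X} [IsFiniteMeasure m] {F : X × X → ℝ}
    (hF : Integrable F (m.prod m)) (hdiag : Integrable (fun x => F (x, x)) m)
    (h : ∀ (n : ℕ) (x : Fin n → X), 0 ≤ ∑ i, ∑ j, F (x i, x j)) :
    0 ≤ ∫ q, F q ∂(m.prod m) := by
  rcases eq_or_ne m 0 with rfl | hm
  · simp
  have : NeZero m := ⟨hm⟩
  set c : ENNReal := (m Set.univ)⁻¹
  have hc : c ≠ ⊤ := ENNReal.inv_ne_top.2 (Measure.measure_univ_ne_zero.2 hm)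
  have hc0 : c ≠ 0 := ENNReal.inv_ne_zero.2 (measure_ne_top _ _)
  have hprod : (c • m).prod (c • m) = c • c • m.prod m := by
    rw [Measure.prod_smul_left, Measure.prod_smul_right]
  have : IsProbabilityMeasure (c • m) := isProbabilityMeasureSMul
  have := integral_prod_nonneg_of_forall_sum_nonneg_of_isProbabilityMeasure (P := c • m) (F := F)
    (by rw [hprod]; exact (hF.smul_measure hc).smul_measure hc) (hdiag.smul_measure hc) h
  rw [hprod, integral_smul_measure, integral_smul_measure, smul_eq_mul, smul_eq_mul] at this
  have hpos : 0 < c.toReal := ENNReal.toReal_pos hc0 hc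
  exact nonneg_of_mul_nonneg_right (nonneg_of_mul_nonneg_right this hpos) hpos

theorem IsPosSemidefKernel.integrable {X : Type*} [MeasurableSpace X] {m : Measure X}
    [IsFiniteMeasure m] {K : X → X → ℝ} (hK : IsPosSemidefKernel K)
    (hmeas : AEStronglyMeasurable (fun q : X × X => K q.1 q.2) (m.prod m))
    (hdiag : Integrable (fun x => K x x) m) :
    Integrable (fun q : X × X => K q.1 q.2) (m.prod m) :=
  (((hdiag.comp_fst m).add (hdiag.comp_snd m)).div_const 2).mono' hmeas
    (ae_of_all _ fun q => hK.abs_le q.1 q.2)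

theorem IsPosSemidefKernel.integral_nonneg {X : Type*} [MeasurableSpace X] {m : Measure X}
    [IsFiniteMeasure m] {K : X → X → ℝ} (hK : IsPosSemidefKernel K)
    (hmeas : AEStronglyMeasurable (fun q : X × X => K q.1 q.2) (m.prod m))
    (hdiag : Integrable (fun x => K x x) m) :
    0 ≤ ∫ q, K q.1 q.2 ∂(m.prod m) :=
  integral_prod_nonneg_of_forall_sum_nonneg (hK.integrable hmeas hdiag) hdiag fun n x => by
    -- Unit weights suffice, since the sampling carries the measure; signs will be absorbed into the
    -- kernel.
    simpa using hK.sum_nonneg n x 1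

/-! ### Inner regular measures and measurability on products. -/

section InnerRegular

variable {X Y : Type*} [MetricSpace X] [MeasurableSpace X] [BorelSpace X]
  [MetricSpace Y] [MeasurableSpace Y] [BorelSpace Y]

/-- Exhaust the mass by countably many compact sets; compact metric spaces are separable. -/
theorem exists_isSeparable_measure_compl_eq_zero (m : Measure X) [IsFiniteMeasure m]
    [m.InnerRegular] :
    ∃ S : Set X, MeasurableSet S ∧ TopologicalSpace.IsSeparable S ∧ m Sᶜ = 0 := by
  have h : ∀ n : ℕ, ∃ K : Set X, IsCompact K ∧ m Kᶜ < ((n : ENNReal) + 1)⁻¹ := by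
    intro n
    obtain ⟨K, -, hK, hlt⟩ := MeasurableSet.univ.exists_isCompact_sdiff_lt (μ := m)
      (measure_ne_top _ _) (ε := ((n : ENNReal) + 1)⁻¹) (by simp)
    exact ⟨K, hK, by rwa [Set.compl_eq_univ_sdiff]⟩
  choose K hK hlt using h
  refine ⟨⋃ n, K n, .iUnion fun n => (hK n).measurableSet,
    .iUnion fun n => (hK n).isSeparable, ?_⟩
  refine le_antisymm (le_of_forall_pos_le_add fun ε hε => ?_) zero_le
  obtain ⟨n, hn⟩ := ENNReal.exists_inv_nat_lt hε.ne'
  rw [zero_add]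
  calc m (⋃ n, K n)ᶜ ≤ m (K n)ᶜ :=
        measure_mono (Set.compl_subset_compl.2 (Set.subset_iUnion K n))
    _ ≤ ((n : ENNReal) + 1)⁻¹ := (hlt n).le
    _ ≤ (n : ENNReal)⁻¹ := ENNReal.inv_le_inv.2 le_self_add
    _ ≤ ε := hn.le

/-- Continuous functions on a product are almost everywhere measurable with respect to products of
inner regular measures, even when the Borel σ-algebra is larger than the product σ-algebra. -/
theorem Continuous.aestronglyMeasurable_prod_of_innerRegular {F : X × Y → ℝ} (hF : Continuous F)
    (m : Measure X) [IsFiniteMeasure m] [m.InnerRegular]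
    (n : Measure Y) [IsFiniteMeasure n] [n.InnerRegular] :
    AEStronglyMeasurable F (m.prod n) := by
  obtain ⟨S, hS, hSsep, hS0⟩ := exists_isSeparable_measure_compl_eq_zero m
  obtain ⟨T, hT, hTsep, hT0⟩ := exists_isSeparable_measure_compl_eq_zero n
  have := hSsep.separableSpace
  have := hTsep.separableSpace
  have := UniformSpace.secondCountable_of_separable S
  have := UniformSpace.secondCountable_of_separable T
  -- On `S × T`, second countable, the Borel and product σ-algebras agree, so `F` is measurable
  -- there and extends measurably.
  have hφ : MeasurableEmbedding (Prod.map (Subtype.val : S → X) (Subtype.val : T → Y)) :=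
    (MeasurableEmbedding.subtype_coe hS).prodMap (MeasurableEmbedding.subtype_coe hT)
  have hc : Measurable (F ∘ Prod.map (Subtype.val : S → X) (Subtype.val : T → Y)) :=
    (hF.comp (continuous_subtype_val.prodMap continuous_subtype_val)).measurable
  obtain ⟨G, hG, hGF⟩ := hφ.exists_measurable_extend hc fun _ => ⟨0⟩
  refine ⟨G, hG.stronglyMeasurable, ?_⟩
  have h1 : ∀ᵐ q ∂m.prod n, q.1 ∈ S := Measure.quasiMeasurePreserving_fst.ae (mem_ae_iff.2 hS0)
  have h2 : ∀ᵐ q ∂m.prod n, q.2 ∈ T := Measure.quasiMeasurePreserving_snd.ae (mem_ae_iff.2 hT0)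
  filter_upwards [h1, h2] with q hq1 hq2
  exact (congrFun hGF (⟨q.1, hq1⟩, ⟨q.2, hq2⟩)).symm

end InnerRegular

/-! ### Integration against signed measures. -/

section SignedMeasure

variable {X : Type*} [MeasurableSpace X]

theorem signedMeasure_posPart_le_variation (μ : SignedMeasure X) :
    μ.toJordanDecomposition.posPart ≤ μ.variation := by
  rw [← SignedMeasure.totalVariation_eq_variation, SignedMeasure.totalVariation]
  exact Measure.le_add_right le_rfl

theorem signedMeasure_negPart_le_variation (μ : SignedMeasure X) :
    μ.toJordanDecomposition.negPart ≤ μ.variation := by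
  rw [← SignedMeasure.totalVariation_eq_variation, SignedMeasure.totalVariation]
  exact Measure.le_add_left le_rfl

theorem lsmul_real_flip :
    (ContinuousLinearMap.lsmul ℝ ℝ : ℝ →L[ℝ] ℝ →L[ℝ] ℝ).flip = ContinuousLinearMap.lsmul ℝ ℝ := by
  ext
  simp

theorem variation_toSignedMeasure_le (m : Measure X) [IsFiniteMeasure m] :
    m.toSignedMeasure.variation ≤ m := by
  refine VectorMeasure.variation_le_of_forall_enorm_le fun s hs => ?_
  rw [Measure.toSignedMeasure_apply_measurable hs, Real.enorm_of_nonneg measureReal_nonneg,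
    measureReal_def, ENNReal.ofReal_toReal (measure_ne_top _ _)]

theorem signedMeasure_integral_eq_sub (μ : SignedMeasure X) {g : X → ℝ}
    (hg : Integrable g μ.variation) :
    μ.integral g (ContinuousLinearMap.lsmul ℝ ℝ) =
      ∫ x, g x ∂μ.toJordanDecomposition.posPart - ∫ x, g x ∂μ.toJordanDecomposition.negPart := by
  conv_lhs => rw [← SignedMeasure.toSignedMeasure_toJordanDecomposition μ]
  rw [JordanDecomposition.toSignedMeasure, VectorMeasure.integral_sub_vectorMeasure,
    ← lsmul_real_flip, VectorMeasure.integral_toSignedMeasure,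
    VectorMeasure.integral_toSignedMeasure]
  · exact hg.mono_measure
      ((variation_toSignedMeasure_le _).trans (signedMeasure_posPart_le_variation μ))
  · exact hg.mono_measure
      ((variation_toSignedMeasure_le _).trans (signedMeasure_negPart_le_variation μ))

/-- Polar decomposition of a signed measure, for integrals. -/
theorem exists_sign_integral_eq (μ : SignedMeasure X) :
    ∃ f : X → ℝ, Measurable f ∧ (∀ x, |f x| = 1) ∧
      ∀ g : X → ℝ, μ.integral g (ContinuousLinearMap.lsmul ℝ ℝ) =
        ∫ x, f x * g x ∂μ.variation := by
  classical
  obtain ⟨t, ht, hpos, hneg⟩ := μ.toJordanDecomposition.mutuallySingular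
  -- `t` is null for the positive part and its complement for the negative part, so the sign is `-1`
  -- exactly on `t`.
  have hf : Measurable (t.piecewise (fun _ => (-1 : ℝ)) fun _ => 1) :=
    measurable_const.piecewise ht measurable_const
  refine ⟨_, hf, fun x => by by_cases hx : x ∈ t <;> simp [hx], fun g => ?_⟩
  set f := t.piecewise (fun _ => (-1 : ℝ)) fun _ => 1
  have hff : ∀ x, f x * (f x * g x) = g x := fun x => by
    by_cases hx : x ∈ t <;> simp [f, hx]
  have hbound : ∀ x, ‖f x‖ ≤ 1 := fun x => by by_cases hx : x ∈ t <;> simp [f, hx]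
  by_cases hg : Integrable g μ.variation
  · have hfg : Integrable (fun x => f x * g x) μ.variation :=
      hg.bdd_mul hf.aestronglyMeasurable (ae_of_all _ hbound)
    have hfp := hfg.mono_measure (signedMeasure_posPart_le_variation μ)
    have hfn := hfg.mono_measure (signedMeasure_negPart_le_variation μ)
    rw [signedMeasure_integral_eq_sub μ hg, ← SignedMeasure.totalVariation_eq_variation,
      SignedMeasure.totalVariation, integral_add_measure hfp hfn, sub_eq_add_neg, ← integral_neg]
    congr 1
    · refine integral_congr_ae ?_
      filter_upwards [measure_eq_zero_iff_ae_notMem.1 hpos] with x hx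
      simp [f, hx]
    · refine integral_congr_ae ?_
      filter_upwards [measure_eq_zero_iff_ae_notMem.1 hneg] with x hx
      have hx' : x ∈ t := by simpa using hx
      simp [f, hx']
  -- Both sides take the default value 0: as `f² = 1`, integrability of `f g` would give that of
  -- `g`.
  · rw [VectorMeasure.integral_undef hg, integral_undef]
    intro h
    refine hg ((h.bdd_mul hf.aestronglyMeasurable (ae_of_all _ hbound)).congr
      (ae_of_all _ fun x => hff x))

end SignedMeasure

/-! ### Stone–Weierstrass for finite inner regular measures. -/

section StoneWeierstrass

open Real BoundedContinuousFunction

variable {X : Type*} [MetricSpace X] [MeasurableSpace X] [BorelSpace X]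
  {P P' : Measure X} [IsFiniteMeasure P] [IsFiniteMeasure P'] [P.InnerRegular] [P'.InnerRegular]

/-- The truncation `y ↦ y exp (-ε y²)` is of size at most `1/√ε`, so a set of mass below `ε`
contributes at most `√ε`. For each measure the error `3√ε` is two such tails plus the approximation
of `f` by `g ∈ A` on a compact set; the truncated integrals of `g` agree. -/
theorem abs_integral_mulExpNegMulSq_comp_sub_le_of_innerRegular (f : X →ᵇ ℝ)
    {A : Subalgebra ℝ (X →ᵇ ℝ)} (hA : (A.map (toContinuousMapₐ ℝ)).SeparatesPoints)
    (heq : ∀ g ∈ A, ∫ x, g x ∂P = ∫ x, g x ∂P') {ε : ℝ} (hε : 0 < ε) :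
    |∫ x, mulExpNegMulSq ε (f x) ∂P - ∫ x, mulExpNegMulSq ε (f x) ∂P'| ≤ 6 * √ε := by
  -- The added 1 keeps `c` positive even when both measures vanish.
  set c : ℝ := max (P.real Set.univ) (P'.real Set.univ) + 1
  have hcP : P.real Set.univ ≤ c := (le_max_left _ _).trans (le_add_of_nonneg_right zero_le_one)
  have hcP' : P'.real Set.univ ≤ c := (le_max_right _ _).trans (le_add_of_nonneg_right zero_le_one)
  have hc : 0 < c := add_pos_of_nonneg_of_pos (le_max_of_le_left measureReal_nonneg) one_pos
  obtain ⟨KP, -, hKP, hKPlt⟩ := MeasurableSet.univ.exists_isCompact_sdiff_lt (μ := P)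
    (measure_ne_top _ _) (ENNReal.ofReal_pos.2 hε).ne'
  obtain ⟨KP', -, hKP', hKPlt'⟩ := MeasurableSet.univ.exists_isCompact_sdiff_lt (μ := P')
    (measure_ne_top _ _) (ENNReal.ofReal_pos.2 hε).ne'
  rw [← Set.compl_eq_univ_sdiff] at hKPlt hKPlt'
  have hK : IsCompact (KP ∪ KP') := hKP.union hKP'
  have hPlt : P (KP ∪ KP')ᶜ < ε.toNNReal :=
    (measure_mono (Set.compl_subset_compl.2 Set.subset_union_left)).trans_lt hKPlt
  have hPlt' : P' (KP ∪ KP')ᶜ < ε.toNNReal :=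
    (measure_mono (Set.compl_subset_compl.2 Set.subset_union_right)).trans_lt hKPlt'
  obtain ⟨_, ⟨g, hgA, rfl⟩, hg⟩ :=
    ContinuousMap.exists_mem_subalgebra_near_continuous_of_isCompact_of_separatesPoints
      hA (f : C(X, ℝ)) hK (mul_pos (sqrt_pos_of_pos hε) (inv_pos.2 hc))
  have bound : ∀ (Q : Measure X) [IsFiniteMeasure Q], Q (KP ∪ KP')ᶜ < ε.toNNReal →
      Q.real Set.univ ≤ c →
      |∫ x, mulExpNegMulSq ε (g x) ∂Q - ∫ x, mulExpNegMulSq ε (f x) ∂Q| ≤ 3 * √ε := by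
    intro Q _ hQ hQc
    have h1 := abs_integral_sub_setIntegral_mulExpNegMulSq_comp_lt (P := Q) (f : C(X, ℝ))
      hK.measurableSet hε hQ
    have h2 := abs_integral_sub_setIntegral_mulExpNegMulSq_comp_lt (P := Q) (g : C(X, ℝ))
      hK.measurableSet hε hQ
    have h3 := abs_setIntegral_mulExpNegMulSq_comp_sub_le_mul_measure (P := Q) hK hK.measurableSet
      (f : C(X, ℝ)) (g : C(X, ℝ)) hε hg
    have h4 : √ε * c⁻¹ * (Q (KP ∪ KP')).toReal ≤ √ε := by
      rw [mul_assoc]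
      refine mul_le_of_le_one_right (sqrt_nonneg _) ?_
      rw [inv_mul_le_one₀ hc]
      exact (measureReal_mono (Set.subset_univ _)).trans hQc
    change |∫ x, mulExpNegMulSq ε ((g : C(X, ℝ)) x) ∂Q -
      ∫ x, mulExpNegMulSq ε ((f : C(X, ℝ)) x) ∂Q| ≤ 3 * √ε
    rw [abs_lt] at h1 h2
    have h5 := abs_le.1 (h3.trans h4)
    rw [abs_le]
    constructor <;> linarith [h1.1, h1.2, h2.1, h2.2, h5.1, h5.2]
  have hP := abs_le.1 (bound P hPlt hcP)
  have hP' := abs_le.1 (bound P' hPlt' hcP')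
  have := integral_mulExpNegMulSq_comp_eq hε heq hgA
  rw [abs_le]
  constructor <;> linarith [hP.1, hP.2, hP'.1, hP'.2]

/-- A point-separating algebra of bounded continuous functions separates finite inner regular
measures. -/
theorem ext_of_forall_mem_subalgebra_integral_eq_of_innerRegular
    {A : Subalgebra ℝ (X →ᵇ ℝ)} (hA : (A.map (toContinuousMapₐ ℝ)).SeparatesPoints)
    (heq : ∀ g ∈ A, ∫ x, g x ∂P = ∫ x, g x ∂P') : P = P' := by
  refine ext_of_forall_integral_eq_of_IsFiniteMeasure fun f => ?_
  have h0 : Tendsto (fun ε : ℝ => 6 * √ε) (𝓝[>] 0) (𝓝 0) := by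
    have : Tendsto (fun ε : ℝ => 6 * √ε) (𝓝 0) (𝓝 (6 * √0)) :=
      (continuous_const.mul continuous_sqrt).tendsto 0
    rw [sqrt_zero, mul_zero] at this
    exact this.mono_left nhdsWithin_le_nhds
  have lim1 : Tendsto (fun ε => |∫ x, mulExpNegMulSq ε (f x) ∂P - ∫ x, mulExpNegMulSq ε (f x) ∂P'|)
      (𝓝[>] 0) (𝓝 0) :=
    squeeze_zero' (Eventually.of_forall fun _ => abs_nonneg _)
      (eventually_nhdsWithin_of_forall fun ε hε =>
        abs_integral_mulExpNegMulSq_comp_sub_le_of_innerRegular f hA heq hε) h0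
  have lim2 := ((tendsto_integral_mulExpNegMulSq_comp (P := P) f).sub
    (tendsto_integral_mulExpNegMulSq_comp (P := P') f)).abs
  exact eq_of_abs_sub_eq_zero (tendsto_nhds_unique lim2 lim1)

end StoneWeierstrass

/-! ### The energy form on measures of mass zero over a metric space. -/

theorem negDistEnergy_smul_left {X : Type*} [MetricSpace X] [MeasurableSpace X] (c : ℝ)
    (μ ν : SignedMeasure X) :
    negDistEnergy (c • μ) ν = c * negDistEnergy μ ν := by
  simp only [negDistEnergy, VectorMeasure.integral_smul_vectorMeasure]
  rw [VectorMeasure.integral_fun_smul, smul_eq_mul, mul_neg]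

section ZeroMass

variable {X : Type*} [MetricSpace X] [MeasurableSpace X] [BorelSpace X] [Nonempty X]
  {μ ν : SignedMeasure X}

theorem innerRegular_variation_of_mem_zeroMassMeasures (hμ : μ ∈ zeroMassMeasures X) :
    μ.variation.InnerRegular :=
  (isRadonMeasure_variation_iff μ).1 hμ.1

theorem integrable_dist_of_mem_zeroMassMeasures (hμ : μ ∈ zeroMassMeasures X) (z : X) :
    Integrable (fun x => dist x z) μ.variation := by
  have := signedMeasure_variation_finite μ
  obtain ⟨w, hw⟩ := hμ.2.1
  exact integrable_dist_of_integrable_dist hw z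

theorem integrable_dist_prod_of_mem_zeroMassMeasures (hμ : μ ∈ zeroMassMeasures X)
    (hν : ν ∈ zeroMassMeasures X) :
    Integrable (fun q : X × X => dist q.1 q.2) (μ.variation.prod ν.variation) := by
  have := signedMeasure_variation_finite μ
  have := signedMeasure_variation_finite ν
  have := innerRegular_variation_of_mem_zeroMassMeasures hμ
  have := innerRegular_variation_of_mem_zeroMassMeasures hν
  have z : X := Classical.arbitrary X
  refine (((integrable_dist_of_mem_zeroMassMeasures hμ z).comp_fst ν.variation).add
    ((integrable_dist_of_mem_zeroMassMeasures hν z).comp_snd μ.variation)).mono'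
    (continuous_dist.aestronglyMeasurable_prod_of_innerRegular _ _) (ae_of_all _ fun q => ?_)
  rw [Real.norm_of_nonneg dist_nonneg]
  exact dist_triangle_right _ _ _

theorem integrable_sign_mul_dist_prod (hμ : μ ∈ zeroMassMeasures X) (hν : ν ∈ zeroMassMeasures X)
    {f g : X → ℝ} (hf : Measurable f) (hf1 : ∀ x, |f x| = 1) (hg : Measurable g)
    (hg1 : ∀ x, |g x| = 1) :
    Integrable (fun q : X × X => f q.1 * g q.2 * dist q.1 q.2)
      (μ.variation.prod ν.variation) :=
  (integrable_dist_prod_of_mem_zeroMassMeasures hμ hν).bdd_mul (c := 1)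
    ((hf.comp measurable_fst).mul (hg.comp measurable_snd)).aestronglyMeasurable
    (ae_of_all _ fun q => by simp [hf1, hg1])

theorem integrable_integral_dist (hμ : μ ∈ zeroMassMeasures X) (hν : ν ∈ zeroMassMeasures X) :
    Integrable (fun y => μ.integral (fun x => dist x y) (ContinuousLinearMap.lsmul ℝ ℝ))
      ν.variation := by
  have := signedMeasure_variation_finite μ
  have := signedMeasure_variation_finite ν
  obtain ⟨f, hf, hf1, hfi⟩ := exists_sign_integral_eq μ
  simp only [hfi]
  simpa using (integrable_sign_mul_dist_prod hμ hν hf hf1 (g := 1) measurable_one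
    (by simp)).integral_prod_right

/-- Fubini after polar decomposition: the energy becomes one integral against a positive product
measure, where symmetry and positivity are accessible. -/
theorem negDistEnergy_eq_integral_prod (hμ : μ ∈ zeroMassMeasures X) (hν : ν ∈ zeroMassMeasures X)
    {f g : X → ℝ} (hf : Measurable f) (hf1 : ∀ x, |f x| = 1) (hg : Measurable g)
    (hg1 : ∀ x, |g x| = 1)
    (hfi : ∀ k : X → ℝ, μ.integral k (ContinuousLinearMap.lsmul ℝ ℝ) =
      ∫ x, f x * k x ∂μ.variation)
    (hgi : ∀ k : X → ℝ, ν.integral k (ContinuousLinearMap.lsmul ℝ ℝ) =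
      ∫ x, g x * k x ∂ν.variation) :
    negDistEnergy μ ν =
      -∫ q, f q.1 * g q.2 * dist q.1 q.2 ∂(μ.variation.prod ν.variation) := by
  have := signedMeasure_variation_finite μ
  have := signedMeasure_variation_finite ν
  rw [integral_prod_symm _ (integrable_sign_mul_dist_prod hμ hν hf hf1 hg hg1), negDistEnergy]
  simp only [hfi, hgi]
  congr 1
  refine integral_congr_ae (ae_of_all _ fun y => ?_)
  simp only
  rw [← integral_const_mul]
  exact integral_congr_ae (ae_of_all _ fun x => by ring)

theorem negDistEnergy_comm (hμ : μ ∈ zeroMassMeasures X) (hν : ν ∈ zeroMassMeasures X) :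
    negDistEnergy μ ν = negDistEnergy ν μ := by
  have := signedMeasure_variation_finite μ
  have := signedMeasure_variation_finite ν
  obtain ⟨f, hf, hf1, hfi⟩ := exists_sign_integral_eq μ
  obtain ⟨g, hg, hg1, hgi⟩ := exists_sign_integral_eq ν
  rw [negDistEnergy_eq_integral_prod hμ hν hf hf1 hg hg1 hfi hgi,
    negDistEnergy_eq_integral_prod hν hμ hg hg1 hf hf1 hgi hfi, ← integral_prod_swap]
  congr 1
  refine integral_congr_ae (ae_of_all _ fun q => ?_)
  simp only [Prod.fst_swap, Prod.snd_swap, dist_comm q.2 q.1]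
  ring

theorem negDistEnergy_add_left {μ' : SignedMeasure X} (hμ : μ ∈ zeroMassMeasures X)
    (hμ' : μ' ∈ zeroMassMeasures X) (hν : ν ∈ zeroMassMeasures X) :
    negDistEnergy (μ + μ') ν = negDistEnergy μ ν + negDistEnergy μ' ν := by
  have h : ∀ y, (μ + μ').integral (fun x => dist x y) (ContinuousLinearMap.lsmul ℝ ℝ) =
      μ.integral (fun x => dist x y) (ContinuousLinearMap.lsmul ℝ ℝ) +
        μ'.integral (fun x => dist x y) (ContinuousLinearMap.lsmul ℝ ℝ) := fun y =>
    VectorMeasure.integral_add_vectorMeasure (integrable_dist_of_mem_zeroMassMeasures hμ y)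
      (integrable_dist_of_mem_zeroMassMeasures hμ' y)
  simp only [negDistEnergy, h]
  rw [VectorMeasure.integral_fun_add (integrable_integral_dist hμ hν)
    (integrable_integral_dist hμ' hν), neg_add]

end ZeroMass

/-! ### Positivity and definiteness of the energy on hyperbolic space. -/

namespace RealHyperbolicSpace

variable {E : Type*} [NormedAddCommGroup E] [InnerProductSpace ℝ E]

/-- The base point `(0, 1)` of the hyperboloid. -/
def basePoint : RealHyperbolicSpace E := ⟨0, 1, one_pos, by simp⟩

theorem height_eq_cosh (p : RealHyperbolicSpace E) : p.height = Real.cosh (dist p basePoint) := by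
  simp [cosh_dist, form, basePoint]

@[fun_prop]
theorem continuous_height : Continuous (height : RealHyperbolicSpace E → ℝ) := by
  rw [funext (height_eq_cosh (E := E))]
  fun_prop

@[fun_prop]
theorem continuous_point : Continuous (point : RealHyperbolicSpace E → E) := by
  refine continuous_iff_continuousAt.2 fun q => ?_
  rw [ContinuousAt, tendsto_iff_norm_sub_tendsto_zero]
  -- Polarization on the hyperboloid expresses the norm distance through heights and `d`, so
  -- continuity of `point` follows from that of `height`.
  have h : ∀ p : RealHyperbolicSpace E, ‖p.point - q.point‖ =
      √((p.height - q.height) ^ 2 + 2 * Real.cosh (dist p q) - 2) := by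
    intro p
    rw [← Real.sqrt_sq (norm_nonneg (p.point - q.point)), norm_sub_sq_real, cosh_dist, form]
    congr 1
    linarith [p.height_sq_sub, q.height_sq_sub]
  simp only [h]
  have hc : Continuous fun p : RealHyperbolicSpace E =>
      √((p.height - q.height) ^ 2 + 2 * Real.cosh (dist p q) - 2) := by fun_prop
  simpa using hc.tendsto q

theorem log_height_nonneg (p : RealHyperbolicSpace E) : 0 ≤ Real.log p.height :=
  Real.log_nonneg p.one_le_height

/-- `cosh r ≤ exp r` for `r ≥ 0`. This makes the one-variable terms of `distKernel` integrable. -/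
theorem log_height_le_dist (p : RealHyperbolicSpace E) :
    Real.log p.height ≤ dist p basePoint := by
  rw [Real.log_le_iff_le_exp p.height_pos, height_eq_cosh, Real.cosh_eq]
  have : Real.exp (-dist p basePoint) ≤ Real.exp (dist p basePoint) :=
    Real.exp_le_exp.2 (by linarith [dist_nonneg (x := p) (y := basePoint)])
  linarith

variable {μ : SignedMeasure (RealHyperbolicSpace E)}

theorem integrable_log_height (hμ : μ ∈ zeroMassMeasures (RealHyperbolicSpace E)) :
    Integrable (fun p => Real.log p.height) μ.variation := by
  refine (integrable_dist_of_mem_zeroMassMeasures hμ basePoint).mono'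
    (continuous_height.log fun p => p.height_pos.ne').aestronglyMeasurable
    (ae_of_all _ fun p => ?_)
  rw [Real.norm_of_nonneg p.log_height_nonneg]
  exact p.log_height_le_dist

theorem continuous_distKernel :
    Continuous fun q : RealHyperbolicSpace E × RealHyperbolicSpace E => distKernel q.1 q.2 := by
  have h : Continuous fun p : RealHyperbolicSpace E => Real.log p.height :=
    continuous_height.log fun p => p.height_pos.ne'
  exact ((continuous_const.add (h.comp continuous_fst)).add (h.comp continuous_snd)).sub
    continuous_dist

/-- Integrate the positive semidefinite difference against `μ ⊗ μ`: zero mass kills the terms in one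
variable, leaving the energy minus `c (∫ h dμ)²`. -/
theorem mul_sq_integral_le_negDistEnergy (hμ : μ ∈ zeroMassMeasures (RealHyperbolicSpace E))
    (h : RealHyperbolicSpace E →ᵇ ℝ) {c : ℝ}
    (hK : IsPosSemidefKernel fun p q => distKernel p q - c * (h p * h q)) :
    c * μ.integral h (ContinuousLinearMap.lsmul ℝ ℝ) ^ 2 ≤ negDistEnergy μ μ := by
  have := signedMeasure_variation_finite μ
  have := innerRegular_variation_of_mem_zeroMassMeasures hμ
  obtain ⟨f, hf, hf1, hfi⟩ := exists_sign_integral_eq μ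
  set m := μ.variation
  have hfb : ∀ᵐ x ∂m, ‖f x‖ ≤ 1 := ae_of_all _ fun x => (hf1 x).le
  have hff : ∀ x, f x * f x = 1 := fun x => by rw [← abs_mul_abs_self, hf1, one_mul]
  have hlog := integrable_log_height hμ
  have hmass : ∫ x, f x ∂m = 0 := by
    have h1 := hfi fun _ => 1
    rw [VectorMeasure.integral_const, hμ.2.2] at h1
    simpa using h1.symm
  have hf_int : Integrable f m := by
    simpa using (integrable_const (1 : ℝ)).bdd_mul hf.aestronglyMeasurable hfb
  have hflog : Integrable (fun x => f x * Real.log x.height) m :=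
    hlog.bdd_mul hf.aestronglyMeasurable hfb
  have hfh : Integrable (fun x => f x * h x) m :=
    (h.integrable m).bdd_mul hf.aestronglyMeasurable hfb
  have hd := integrable_sign_mul_dist_prod hμ hμ hf hf1 hf hf1
  -- Multiplying by `f ⊗ f` trades the signed measure for its variation; on the diagonal `f² = 1`
  -- and `d = 0`.
  have hpos := ((IsPosSemidefKernel.rankOne f).mul hK).integral_nonneg (m := m)
    (((hf.comp measurable_fst).mul (hf.comp measurable_snd)).aestronglyMeasurable.mul
      (Continuous.aestronglyMeasurable_prod_of_innerRegular
        (continuous_distKernel.sub (by fun_prop)) m m)) (by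
      simp only [hff, one_mul, distKernel, dist_self, sub_zero]
      exact (((integrable_const _).add hlog).add hlog).sub (((h * h).integrable m).const_mul c))
  have hexp : ∀ q : RealHyperbolicSpace E × RealHyperbolicSpace E,
      f q.1 * f q.2 * (distKernel q.1 q.2 - c * (h q.1 * h q.2)) =
        Real.log 2 * (f q.1 * f q.2) + (f q.1 * Real.log q.1.height) * f q.2 +
          f q.1 * (f q.2 * Real.log q.2.height) - f q.1 * f q.2 * dist q.1 q.2 -
          c * ((f q.1 * h q.1) * (f q.2 * h q.2)) := by
    intro q
    rw [distKernel]
    ring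
  have i1 := (hf_int.mul_prod hf_int).const_mul (Real.log 2)
  have i2 := hflog.mul_prod hf_int
  have i3 := hf_int.mul_prod hflog
  have i4 := (hfh.mul_prod hfh).const_mul c
  simp only [hexp] at hpos
  have i12 := i1.fun_add i2
  have i123 := i12.fun_add i3
  rw [integral_sub (i123.sub' hd) i4, integral_sub i123 hd, integral_add i12 i3, integral_add i1 i2,
    integral_const_mul, integral_const_mul, integral_prod_mul f f, integral_prod_mul (fun x => f x * Real.log x.height) f,
    integral_prod_mul f (fun x => f x * Real.log x.height),
    integral_prod_mul (fun x => f x * h x) (fun x => f x * h x), hmass] at hpos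
  rw [negDistEnergy_eq_integral_prod hμ hμ hf hf1 hf hf1 hfi hfi, hfi]
  linarith

theorem negDistEnergy_self_nonneg (hμ : μ ∈ zeroMassMeasures (RealHyperbolicSpace E)) :
    0 ≤ negDistEnergy μ μ := by
  have := mul_sq_integral_le_negDistEnergy hμ 0 (c := 0)
    (by simpa using! isPosSemidefKernel_distKernel)
  simpa using this

/-- Bounded continuous functions whose rank one kernel is dominated by `[p,q]⁻²`. -/
def dominatedFunctions (E : Type*) [NormedAddCommGroup E] [InnerProductSpace ℝ E] :
    Set (RealHyperbolicSpace E →ᵇ ℝ) :=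
  {g | IsPosSemidefKernel fun p q => invFormSq p q - g p * g q}

/-- Products of dominated functions are dominated by higher powers of `w`. The empty product 1 is
kept apart; zero mass disposes of it later. -/
theorem exists_isPosSemidefKernel_of_mem_closure {g : RealHyperbolicSpace E →ᵇ ℝ}
    (hg : g ∈ Submonoid.closure (dominatedFunctions E)) :
    g = 1 ∨ ∃ n : ℕ, IsPosSemidefKernel fun p q => invFormSq p q ^ (n + 1) - g p * g q := by
  induction hg using Submonoid.closure_induction with
  | mem g hg => exact .inr ⟨0, by simpa using! hg⟩
  | one => exact .inl rfl
  | mul g g' _ _ ih ih' =>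
    rcases ih with rfl | ⟨n, hn⟩
    · rwa [one_mul]
    rcases ih' with rfl | ⟨n', hn'⟩
    · rw [mul_one]
      exact .inr ⟨n, hn⟩
    refine .inr ⟨n + n' + 1, ?_⟩
    convert (isPosSemidefKernel_invFormSq.pow (n + 1)).mul_sub_mul (.rankOne g') hn hn'
      using 3 with p q
    simp only [BoundedContinuousFunction.coe_mul, Pi.mul_apply]
    ring

theorem integral_eq_zero_of_mem_adjoin (hμ : μ ∈ zeroMassMeasures (RealHyperbolicSpace E))
    (h0 : negDistEnergy μ μ = 0) {g : RealHyperbolicSpace E →ᵇ ℝ}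
    (hg : g ∈ Algebra.adjoin ℝ (dominatedFunctions E)) :
    μ.integral g (ContinuousLinearMap.lsmul ℝ ℝ) = 0 := by
  have := signedMeasure_variation_finite μ
  -- The algebra is the linear span of finite products, so linearity leaves only products to treat.
  rw [← Subalgebra.mem_toSubmodule, Algebra.adjoin_eq_span] at hg
  induction hg using Submodule.span_induction with
  | mem g hg =>
    rcases exists_isPosSemidefKernel_of_mem_closure hg with rfl | ⟨n, hn⟩
    · have := VectorMeasure.integral_const (μ := μ) (B := ContinuousLinearMap.lsmul ℝ ℝ) (1 : ℝ)
      rw [hμ.2.2, map_zero] at this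
      exact this
    · have h1 := mul_sq_integral_le_negDistEnergy hμ g
        (isPosSemidefKernel_distKernel_sub_rankOne hn)
      rw [h0] at h1
      exact pow_eq_zero_iff two_ne_zero |>.1 (le_antisymm
        (nonpos_of_mul_nonpos_right h1 (by positivity)) (sq_nonneg _))
  | zero => exact VectorMeasure.integral_zero
  | add g g' _ _ ih ih' =>
    rw [BoundedContinuousFunction.coe_add, VectorMeasure.integral_add (g.integrable _)
      (g'.integrable _), ih, ih', add_zero]
  | smul a g _ ih =>
    rw [BoundedContinuousFunction.coe_smul, VectorMeasure.integral_fun_smul, ih, smul_zero]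

theorem abs_inv_height_sq_le_one (p : RealHyperbolicSpace E) : |(p.height ^ 2)⁻¹| ≤ 1 := by
  rw [abs_of_pos (inv_pos.2 (pow_pos p.height_pos 2))]
  exact inv_le_one_of_one_le₀ (one_le_pow₀ p.one_le_height)

theorem abs_inv_height_mul_inner_le {w : E} (hw : ‖w‖ ≤ 1) (p : RealHyperbolicSpace E) :
    |p.height⁻¹ * inner ℝ w p.point| ≤ 1 := by
  rw [abs_mul, abs_of_pos (inv_pos.2 p.height_pos), inv_mul_le_one₀ p.height_pos]
  calc |inner ℝ w p.point| ≤ ‖w‖ * ‖p.point‖ := abs_real_inner_le_norm _ _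
    _ ≤ 1 * p.height := by gcongr; exact p.norm_point_lt_height.le
    _ = p.height := one_mul _

/-- The function `(x, t) ↦ t⁻²`. -/
noncomputable def invHeightSq (E : Type*) [NormedAddCommGroup E] [InnerProductSpace ℝ E] :
    RealHyperbolicSpace E →ᵇ ℝ :=
  .ofNormedAddCommGroup (fun p => (p.height ^ 2)⁻¹)
    ((continuous_height.pow 2).inv₀ fun p => (pow_pos p.height_pos 2).ne') 1
    abs_inv_height_sq_le_one

/-- The function `(x, t) ↦ t⁻³ ⟪w, x⟫`. -/
noncomputable def invHeightInner (w : E) (hw : ‖w‖ ≤ 1) : RealHyperbolicSpace E →ᵇ ℝ :=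
  .ofNormedAddCommGroup (fun p => (p.height ^ 2)⁻¹ * (p.height⁻¹ * inner ℝ w p.point))
    (((continuous_height.pow 2).inv₀ fun p => (pow_pos p.height_pos 2).ne').mul
      ((continuous_height.inv₀ fun p => p.height_pos.ne').mul (by fun_prop))) 1
    fun p => by
      rw [norm_mul]
      exact mul_le_one₀ p.abs_inv_height_sq_le_one (norm_nonneg _)
        (p.abs_inv_height_mul_inner_le hw)

theorem separatesPoints_adjoin_dominatedFunctions :
    ((Algebra.adjoin ℝ (dominatedFunctions E)).map
      (BoundedContinuousFunction.toContinuousMapₐ ℝ)).SeparatesPoints := by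
  intro p q hpq
  have key : ∀ g ∈ dominatedFunctions E, g p ≠ g q → ∃ f ∈ (fun f : C(_, ℝ) => (f : _ → ℝ)) ''
      (((Algebra.adjoin ℝ (dominatedFunctions E)).map
        (BoundedContinuousFunction.toContinuousMapₐ ℝ) : Subalgebra ℝ _) : Set _), f p ≠ f q :=
    fun g hg hne => ⟨g, ⟨_, ⟨g, Algebra.subset_adjoin hg, rfl⟩, rfl⟩, hne⟩
  -- At equal heights, pair with the unit vector along `p.point - q.point`; at different heights,
  -- `t⁻²` separates.
  by_cases hh : p.height = q.height
  · have hx : p.point - q.point ≠ 0 := fun h =>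
      hpq (RealHyperbolicSpace.ext (sub_eq_zero.1 h) hh)
    have hn : ‖(‖p.point - q.point‖⁻¹ • (p.point - q.point))‖ ≤ 1 :=
      (norm_smul_inv_norm (𝕜 := ℝ) hx).le
    refine key (invHeightInner _ hn) (isPosSemidefKernel_invFormSq_sub_inner hn) fun h => hx ?_
    have h1 : (p.height ^ 2)⁻¹ * (p.height⁻¹ * inner ℝ _ p.point) =
      (q.height ^ 2)⁻¹ * (q.height⁻¹ * inner ℝ _ q.point) := h
    have hq := q.height_pos
    rw [hh, mul_right_inj' (by positivity), mul_right_inj' (by positivity), ← sub_eq_zero,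
      ← inner_sub_right, real_inner_smul_left, real_inner_self_eq_norm_sq, mul_eq_zero,
      inv_eq_zero, pow_eq_zero_iff two_ne_zero, or_self, norm_eq_zero] at h1
    exact h1
  · refine key (invHeightSq E) isPosSemidefKernel_invFormSq_sub_height fun h => hh ?_
    exact (pow_left_inj₀ p.height_pos.le q.height_pos.le two_ne_zero).1 (inv_injective h)

theorem eq_zero_of_negDistEnergy_self_eq_zero
    (hμ : μ ∈ zeroMassMeasures (RealHyperbolicSpace E)) (h0 : negDistEnergy μ μ = 0) : μ = 0 := by
  have := signedMeasure_variation_finite μ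
  have hr := innerRegular_variation_of_mem_zeroMassMeasures hμ
  have := innerRegular_of_le (signedMeasure_posPart_le_variation μ) hr
  have := innerRegular_of_le (signedMeasure_negPart_le_variation μ) hr
  have h := ext_of_forall_mem_subalgebra_integral_eq_of_innerRegular
    (P := μ.toJordanDecomposition.posPart) (P' := μ.toJordanDecomposition.negPart)
    separatesPoints_adjoin_dominatedFunctions fun g hg => by
      have h1 := integral_eq_zero_of_mem_adjoin hμ h0 hg
      rwa [signedMeasure_integral_eq_sub μ (g.integrable _), sub_eq_zero] at h1
  rw [← SignedMeasure.toSignedMeasure_toJordanDecomposition μ,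
    JordanDecomposition.toSignedMeasure]
  simp only [h, sub_self]

theorem isStrongNegativeType : IsStrongNegativeType (RealHyperbolicSpace E) where
  negative_type := dist_negativeType
  strong P Q _ _ hP hQ hPd hQd h0 := by
    rw [isRadonMeasure_iff_innerRegular] at hP hQ
    -- Domination by `P + Q` transfers both regularity and integrability of the distance to the
    -- difference.
    have hle : (P.toSignedMeasure - Q.toSignedMeasure).variation ≤ P + Q :=
      VectorMeasure.variation_sub_le.trans
        (add_le_add (variation_toSignedMeasure_le P) (variation_toSignedMeasure_le Q))
    have hmem : P.toSignedMeasure - Q.toSignedMeasure ∈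
        zeroMassMeasures (RealHyperbolicSpace E) :=
      ⟨isRadonMeasure_variation_of_le hle inferInstance, ⟨basePoint,
        ((hPd basePoint).add_measure (hQd basePoint)).mono_measure hle⟩, by simp⟩
    have := eq_zero_of_negDistEnergy_self_eq_zero hmem h0
    exact Measure.toSignedMeasure_eq_toSignedMeasure_iff.1 (sub_eq_zero.1 this)

end RealHyperbolicSpace

theorem theorem4p2 (E : Type*) [NormedAddCommGroup E] [InnerProductSpace ℝ E] [CompleteSpace E] :
    -- integrability of the distance to some point gives integrability of the distance to all points
    (∀ η ∈ zeroMassMeasures (RealHyperbolicSpace E), ∀ z : RealHyperbolicSpace E,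
      Integrable (fun x => dist x z) η.variation) ∧
    -- the double integrals converge absolutely
    (∀ μ ∈ zeroMassMeasures (RealHyperbolicSpace E),
      ∀ ν ∈ zeroMassMeasures (RealHyperbolicSpace E),
        Integrable (fun q : RealHyperbolicSpace E × RealHyperbolicSpace E => dist q.1 q.2)
          (μ.variation.prod ν.variation)) ∧
    -- `-∫∫ d(x,y) dμ(x) dν(y)` is an inner product
    (∃ ip : InnerProductSpace.Core ℝ (zeroMassMeasures (RealHyperbolicSpace E)),
      ∀ μ ν : zeroMassMeasures (RealHyperbolicSpace E),
        ip.inner μ ν = negDistEnergy (μ : SignedMeasure (RealHyperbolicSpace E)) ν) ∧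
    IsStrongNegativeType (RealHyperbolicSpace E) := by
  refine ⟨fun η hη z => integrable_dist_of_mem_zeroMassMeasures hη z,
    fun μ hμ ν hν => integrable_dist_prod_of_mem_zeroMassMeasures hμ hν, ⟨{
      inner := fun μ ν => negDistEnergy (μ : SignedMeasure (RealHyperbolicSpace E)) ν
      conj_inner_symm := fun μ ν => negDistEnergy_comm ν.2 μ.2
      re_inner_nonneg := fun μ => RealHyperbolicSpace.negDistEnergy_self_nonneg μ.2
      add_left := fun μ μ' ν => negDistEnergy_add_left μ.2 μ'.2 ν.2
      smul_left := fun μ ν c => negDistEnergy_smul_left c _ _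
      definite := fun μ h => Subtype.ext
        (RealHyperbolicSpace.eq_zero_of_negDistEnergy_self_eq_zero μ.2 h) }, fun _ _ => rfl⟩,
    RealHyperbolicSpace.isStrongNegativeType⟩
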